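/- Let $\mathbf{F}_q$ be a finite field of characteristic $p$ with $q \equiv 1 \pmod 4$ elements, let $\mathbf{F}_q^{\boxtimes} = \{x^2 \mid x \in \mathbf{F}_q^{\times}\}$ be its set of nonzero squares, and let $\ell \neq p$ be a prime number with $\ell > (q-1)/2$. Let $\alpha \colon \mathbf{F}_q^{\boxtimes} \to \mathbf{Z}/\ell$ be a voltage assignment, that is, a function that is not identically zero and satisfies $\alpha(-s) = -\alpha(s)$ for all $s \in \mathbf{F}_q^{\boxtimes}$. Then $$S^\alpha = \{(s, \alpha(s)) \mid s \in \mathbf{F}_q^{\boxtimes}\}$$ is a generating set of the group $G = \mathbf{F}_q^+ \times \mathbf{Z}/\ell$, closed under inverses and not containing the identity, and it is a CI-subset of $G$: for every subset $T \subset G$ that is closed under inverses and does not contain the identity, if the Cayley graphs $\mathrm{Cay}(G, S^\alpha)$ and $\mathrm{Cay}(G, T)$ are isomorphic as graphs, then there is a group automorphism $f \colon G \to G$ with $f(S^\alpha) = T$. -/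

import Mathlib

/-- The set of (nonzero) quadratic residues `{x ^ 2 | x ≠ 0}` of a field `F`. -/
def quadraticResidues (F : Type*) [Field F] : Set F :=
  {s | ∃ x : F, x ≠ 0 ∧ x ^ 2 = s}

/-- A function `α` from the quadratic residues of `F` to `ℤ/ℓ` is a voltage assignment if it is
not identically zero and satisfies `α (-s) = -α s`. -/
structure IsVoltageAssignment {F : Type*} [Field F] {ℓ : ℕ}
    (α : quadraticResidues F → ZMod ℓ) : Prop where
  exists_ne_zero : ∃ s, α s ≠ 0
  map_neg : ∀ s t : quadraticResidues F, (t : F) = -(s : F) → α t = -α s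

/-- The set `S^α = {(s, α s) | s a quadratic residue}` in the additive group `F × ℤ/ℓ`. -/
def voltageSet {F : Type*} [Field F] {ℓ : ℕ} (α : quadraticResidues F → ZMod ℓ) :
    Set (F × ZMod ℓ) :=
  {g | ∃ s : quadraticResidues F, g = ((s : F), α s)}

/-- A symmetric generating set `S` (not containing the identity, so that its Cayley graph is a
loopless graph) of an additive group `G` is a CI-subset of `G` if every symmetric subset
`T` of `G` (again without the identity) whose Cayley graph is isomorphic, as a graph, to that of
`S` is the image of `S` under some group automorphism of `G`. No condition that `T` generate `G`
is needed: it follows from connectedness of the Cayley graph of `S`. -/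
structure IsCISubset {G : Type*} [AddGroup G] (S : Set G) : Prop where
  zero_notMem : (0 : G) ∉ S
  neg_mem : ∀ s ∈ S, -s ∈ S
  closure_eq_top : AddSubgroup.closure S = ⊤
  exists_addEquiv : ∀ T : Set G, (0 : G) ∉ T → (∀ t ∈ T, -t ∈ T) →
    Nonempty (SimpleGraph.addCayley S ≃g SimpleGraph.addCayley T) →
      ∃ f : G ≃+ G, f '' S = T

/-!
Write `G = F × ℤ/ℓ` and `S = voltageSet α`, and let `φ` be an isomorphism from the Cayley graph of
`S` to that of `T`. The Cayley graph of `S` is a covering of degree `ℓ` of the Paley graph of `F`.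

*Reduction to the base.* The graph of `S` is connected, of degree `(q - 1) / 2 < ℓ`, so that no
automorphism of order `ℓ` fixes a vertex. As `ℓ ^ 2` does not divide `|G| = q * ℓ`, the translations
by `0 × ℤ/ℓ` form a Sylow subgroup of the automorphism group, and after composition with an
automorphism of the graph, `φ` carries the translations by `0 × ℤ/ℓ` to translations by `0 × ℤ/ℓ`
(`SimpleGraph.Preconnected.exists_iso_map_eq_pow`). After a translation, it has the form
`(x, z) ↦ (φ₀ x, β x + c * z)` with `φ₀ 0 = 0` and `β 0 = 0`.

*The base.* Here `φ₀` is an isomorphism from the Paley graph to a Cayley graph of `F`. It conjugates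
the translations of the target to automorphisms of the Paley graph, which by Carlitz's theorem
(`exists_eq_mul_pow_of_pow_card_half_sub`) have the form `x ↦ a * x ^ p ^ j + b`. A counting argument
shows that a regular group of such maps isomorphic to `F` consists of translations
(`eq_add_of_regular_semiaffine`), so `φ₀` is additive
(`Equiv.map_add_of_sub_mem_iff_quadraticResidues`).

*The fibers.* Since `T` contains exactly one element above each `φ₀ s`, with `s` a quadratic
residue, the difference `β (x + s) - β x` does not depend on `x`. Quadratic residues generate `F`,
so `β` is a homomorphism from `F` to `ℤ/ℓ`, and the map is a group automorphism
(`exists_addEquiv_image_voltageSet_eq`).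
-/

/-! ### Base `p` arithmetic of `p ^ n / 2` -/

/-- By Lucas' theorem, `p` does not divide the binomial coefficient of `p ^ n / 2` and `i` as soon
as all base `p` digits of `i` are at most `p / 2`, the common value of the digits of `p ^ n / 2`.
This is the step which adds a lowest digit `a` to `i`. -/
theorem Nat.not_dvd_choose_half_pow_succ {p : ℕ} (hp : p.Prime) (h2 : p % 2 = 1) {n a i : ℕ}
    (ha : a ≤ p / 2) (hi : ¬ p ∣ (p ^ n / 2).choose i) :
    ¬ p ∣ (p ^ (n + 1) / 2).choose (a + p * i) := by
  have := Fact.mk hp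
  have hpn : p ^ n % 2 = 1 := by rw [Nat.pow_mod, h2]; simp
  have hM : p ^ (n + 1) / 2 = p / 2 + p * (p ^ n / 2) := by
    have h1 : p ^ n = 2 * (p ^ n / 2) + 1 := by omega
    have h3 : p ^ (n + 1) = 2 * (p * (p ^ n / 2)) + p := by
      rw [pow_succ]; nth_rewrite 1 [h1]; ring
    omega
  have hlt : p / 2 < p := Nat.div_lt_self hp.pos one_lt_two
  have key := Choose.choose_modEq_choose_mod_mul_choose_div_nat (p := p)
    (n := p ^ (n + 1) / 2) (k := a + p * i)
  rw [hM, Nat.add_mul_mod_self_left, Nat.add_mul_mod_self_left, Nat.add_mul_div_left _ _ hp.pos,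
    Nat.add_mul_div_left _ _ hp.pos, Nat.mod_eq_of_lt hlt, Nat.mod_eq_of_lt (ha.trans_lt hlt),
    Nat.div_eq_of_lt hlt, Nat.div_eq_of_lt (ha.trans_lt hlt), zero_add, zero_add] at key
  rw [hM, key.dvd_iff dvd_rfl, hp.dvd_mul, not_or]
  refine ⟨fun h => ?_, hi⟩
  have := (hp.dvd_factorial).1 (h.trans ((Nat.choose_mul_factorial_mul_factorial ha) ▸
    Dvd.intro _ (mul_assoc _ _ _).symm))
  omega

theorem Nat.not_dvd_choose_half_pow_pow {p : ℕ} (hp : p.Prime) (h2 : p % 2 = 1) {n s : ℕ}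
    (hs : s < n) : ¬ p ∣ (p ^ n / 2).choose (p ^ s) := by
  induction s generalizing n with
  | zero =>
    obtain ⟨n, rfl⟩ := Nat.exists_eq_add_of_lt hs
    have := hp.two_le
    simpa using not_dvd_choose_half_pow_succ hp h2 (n := 0 + n) (a := 1) (i := 0) (by omega)
      (by simpa using hp.one_lt.ne')
  | succ s ih =>
    obtain ⟨n, rfl⟩ := Nat.exists_eq_add_of_lt (Nat.zero_lt_of_lt hs)
    have := not_dvd_choose_half_pow_succ hp h2 (n := 0 + n) (a := 0) (i := p ^ s) (by omega)
      (ih (by omega))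
    simpa only [zero_add, ← pow_succ'] using this

/-- The case of the digits `p / 2, …, p / 2, j, 0, …, 0`, with `s` digits `p / 2`. -/
theorem Nat.not_dvd_choose_half_pow_digits {p : ℕ} (hp : p.Prime) (h2 : p % 2 = 1) {n s j : ℕ}
    (hs : s < n) (hj : j ≤ p / 2) : ¬ p ∣ (p ^ n / 2).choose (p ^ s / 2 + j * p ^ s) := by
  induction s generalizing n with
  | zero =>
    obtain ⟨n, rfl⟩ := Nat.exists_eq_add_of_lt hs
    simpa using not_dvd_choose_half_pow_succ hp h2 (n := 0 + n) (a := j) (i := 0) hj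
      (by simpa using hp.one_lt.ne')
  | succ s ih =>
    obtain ⟨n, rfl⟩ := Nat.exists_eq_add_of_lt (Nat.zero_lt_of_lt hs)
    have := not_dvd_choose_half_pow_succ hp h2 (n := 0 + n) (a := p / 2)
      (i := p ^ s / 2 + j * p ^ s) le_rfl (ih (by omega))
    have hpn : p ^ s % 2 = 1 := by rw [Nat.pow_mod, h2]; simp
    have hM : p ^ (s + 1) / 2 = p / 2 + p * (p ^ s / 2) := by
      have h1 : p ^ s = 2 * (p ^ s / 2) + 1 := by omega
      have h3 : p ^ (s + 1) = 2 * (p * (p ^ s / 2)) + p := by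
        rw [pow_succ]; nth_rewrite 1 [h1]; ring
      omega
    rw [hM]
    convert this using 3
    ring

/-- If multiplication by `p` modulo `p ^ n - 1` permutes `d 0, …, d (n - 1)` cyclically and the sum
of these numbers is as small as possible, only one of the multiplications involves a reduction,
so `d 0` is a power of `p`. -/
theorem Nat.exists_eq_pow_of_cyclic_mul {p n : ℕ} (hp : 2 ≤ p) (hn : n ≠ 0) {d : ℕ → ℕ}
    (hd : ∀ t < n, d (t + 1) = p * d t % (p ^ n - 1)) (hdn : d n = d 0)
    (hsum : (p - 1) * ∑ t ∈ Finset.range n, d t = p ^ n - 1) : ∃ j < n, d 0 = p ^ j := by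
  set Q := p ^ n - 1 with hQ
  have hQ1 : p ^ n = Q + 1 := by
    have : 0 < p ^ n := by positivity
    omega
  have hQ0 : 0 < Q := by
    have := Nat.one_lt_pow hn (by omega : 1 < p)
    omega
  obtain ⟨e, he⟩ : ∃ e : ℕ → ℕ, ∀ t < n, p * d t = d (t + 1) + Q * e t :=
    ⟨fun t => p * d t / Q, fun t ht => by rw [hd t ht, Nat.mod_add_div]⟩
  have hshift : ∑ t ∈ Finset.range n, d (t + 1) = ∑ t ∈ Finset.range n, d t := by
    have h1 := Finset.sum_range_succ d n
    have h2 := Finset.sum_range_succ' d n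
    omega
  have hE : ∑ t ∈ Finset.range n, e t = 1 := by
    have h1 : p * ∑ t ∈ Finset.range n, d t
        = ∑ t ∈ Finset.range n, d t + Q * ∑ t ∈ Finset.range n, e t := by
      rw [Finset.mul_sum, Finset.sum_congr rfl fun t ht => he t (Finset.mem_range.1 ht),
        Finset.sum_add_distrib, hshift, Finset.mul_sum]
    obtain ⟨r, rfl⟩ := Nat.exists_eq_add_of_le' (by omega : 1 ≤ p)
    rw [Nat.add_sub_cancel] at hsum
    have h2 : Q * ∑ t ∈ Finset.range n, e t = Q * 1 := by linarith
    exact Nat.eq_of_mul_eq_mul_left hQ0 h2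
  obtain ⟨t₀, ht₀, het₀⟩ : ∃ t ∈ Finset.range n, e t ≠ 0 := by
    apply Finset.exists_ne_zero_of_sum_ne_zero
    omega
  have hsplit := Finset.add_sum_erase _ e ht₀
  have he1 : e t₀ = 1 := by omega
  have he0 : ∀ t < n, t ≠ t₀ → e t = 0 := by
    intro t ht htt
    have h0 : ∑ t ∈ (Finset.range n).erase t₀, e t = 0 := by omega
    exact Finset.sum_eq_zero_iff.1 h0 t (Finset.mem_erase.2 ⟨htt, Finset.mem_range.2 ht⟩)
  rw [Finset.mem_range] at ht₀
  have hlow : ∀ t ≤ t₀, d t = p ^ t * d 0 := by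
    intro t ht
    induction t with
    | zero => simp
    | succ t ih =>
      have := he t (by omega)
      rw [he0 t (by omega) (by omega), ih (by omega)] at this
      rw [pow_succ']
      linarith
  have hhigh : ∀ s, t₀ + 1 + s ≤ n → d (t₀ + 1 + s) = p ^ s * d (t₀ + 1) := by
    intro s hs
    induction s with
    | zero => simp
    | succ s ih =>
      have := he (t₀ + 1 + s) (by omega)
      rw [he0 _ (by omega) (by omega), ih (by omega)] at this
      rw [← add_assoc, pow_succ']
      linarith
  obtain ⟨s, rfl⟩ := Nat.exists_eq_add_of_le (by omega : t₀ + 1 ≤ n)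
  have h0 : d 0 = p ^ s * d (t₀ + 1) := by rw [← hdn, hhigh s le_rfl]
  have h1 := he t₀ ht₀
  rw [he1, hlow t₀ le_rfl, h0] at h1
  have h2 : p ^ (t₀ + 1 + s) * d (t₀ + 1) = d (t₀ + 1) + Q := by
    rw [mul_one] at h1
    rw [← h1]
    ring
  rw [hQ1] at h2
  have h3 : d (t₀ + 1) = 1 := Nat.eq_of_mul_eq_mul_left hQ0 (by linarith)
  exact ⟨s, by omega, by rw [h0, h3, mul_one]⟩

open Polynomial

/-! ### Maps preserving the quadratic character of differences -/

theorem Polynomial.eq_of_natDegree_lt_card_of_eval_eq_univ {F : Type*} [Field F] [Fintype F]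
    {P Q : F[X]} (hP : P.natDegree < Fintype.card F) (hQ : Q.natDegree < Fintype.card F)
    (h : ∀ x, P.eval x = Q.eval x) : P = Q := by
  refine Polynomial.eq_of_degrees_lt_of_eval_finset_eq Finset.univ ?_ ?_ fun x _ => h x
  · exact degree_le_natDegree.trans_lt (by exact_mod_cast hP)
  · exact degree_le_natDegree.trans_lt (by exact_mod_cast hQ)

/-- Expanding `(f x - f y) ^ m = (x - y) ^ m`, with `m = |F| / 2`, and extracting a power of `f y`
shows that `f ^ i` is a polynomial function of degree at most `m`, as soon as the
binomial coefficient of the term in `(f x) ^ i` does not vanish in `F`. -/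
theorem exists_polynomial_eval_eq_pow {F : Type*} [Field F] [Fintype F] {f : F → F}
    (hf : Function.Injective f)
    (h : ∀ x y, (f x - f y) ^ (Fintype.card F / 2) = (x - y) ^ (Fintype.card F / 2)) {i : ℕ}
    (hi : (((Fintype.card F / 2).choose i : ℕ) : F) ≠ 0) :
    ∃ R : F[X], R.natDegree ≤ Fintype.card F / 2 ∧ ∀ x, R.eval x = f x ^ i := by
  classical
  set m := Fintype.card F / 2 with hm
  have him : i ≤ m := by
    by_contra hlt
    exact hi (by rw [Nat.choose_eq_zero_of_lt (not_le.1 hlt), Nat.cast_zero])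
  have hmq : m < Fintype.card F := Nat.div_lt_self Fintype.card_pos one_lt_two
  -- the inverse of `y ↦ -f y`
  let e : F ≃ F := Equiv.ofBijective (fun y => -f y)
    (Finite.injective_iff_bijective.1 (neg_injective.comp hf))
  have he : ∀ z, -f (e.symm z) = z := fun z => e.apply_symm_apply z
  -- the functional extracting the coefficient of `(-f y) ^ (m - i)`
  let L : (F → F) →ₗ[F] F := (Polynomial.lcoeff F (m - i)).comp
    ((Lagrange.interpolate Finset.univ (id : F → F)).comp (LinearMap.funLeft F F e.symm))
  have hL : ∀ j ≤ m, L (fun y => (-f y) ^ (m - j)) = if j = i then 1 else 0 := by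
    intro j hj
    have : Lagrange.interpolate Finset.univ (id : F → F)
        (LinearMap.funLeft F F e.symm (fun y => (-f y) ^ (m - j))) = X ^ (m - j) := by
      symm
      refine Lagrange.eq_interpolate_of_eval_eq _ Function.injective_id.injOn ?_ fun z _ => ?_
      · rw [degree_X_pow]
        exact_mod_cast (Nat.sub_le _ _).trans_lt hmq
      · simp [LinearMap.funLeft_apply, he]
    simp only [L, LinearMap.comp_apply, this, lcoeff_apply, coeff_X_pow]
    congr 1
    simp only [eq_iff_iff]
    omega
  have key : ∀ x, ∑ j ∈ Finset.range (m + 1), (f x ^ j * (m.choose j : F)) •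
      (fun y => (-f y) ^ (m - j)) = ∑ j ∈ Finset.range (m + 1), (x ^ j * (m.choose j : F)) •
      (fun y : F => (-y) ^ (m - j)) := by
    intro x
    ext y
    have := h x y
    rw [sub_eq_add_neg, sub_eq_add_neg, add_pow, add_pow] at this
    simp only [Finset.sum_apply, Pi.smul_apply, smul_eq_mul]
    convert this using 2 <;> ring
  refine ⟨∑ j ∈ Finset.range (m + 1), C ((m.choose i : F)⁻¹ * ((m.choose j : F) *
    L (fun y : F => (-y) ^ (m - j)))) * X ^ j, ?_, fun x => ?_⟩
  · refine natDegree_sum_le_of_forall_le _ _ fun j hj => ?_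
    exact (natDegree_C_mul_X_pow_le _ _).trans (Nat.lt_succ_iff.1 (Finset.mem_range.1 hj))
  · have := congrArg L (key x)
    simp only [map_sum, map_smul] at this
    rw [Finset.sum_eq_single_of_mem i (Finset.mem_range.2 (Nat.lt_succ_of_le him)),
      hL i him] at this
    · rw [if_pos rfl, smul_eq_mul, mul_one] at this
      rw [eval_finsetSum, ← mul_right_inj' hi, mul_comm _ (f x ^ i), this, Finset.mul_sum]
      refine Finset.sum_congr rfl fun j _ => ?_
      simp only [eval_mul, eval_C, eval_pow, eval_X, smul_eq_mul]
      field_simp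
    · intro j hj hji
      rw [hL j (Nat.lt_succ_iff.1 (Finset.mem_range.1 hj)), if_neg hji, smul_zero]

/-- Carlitz's theorem: a map which preserves the quadratic character of differences and fixes `0`
is a multiple of a power of the Frobenius. The polynomials `R t` of degree at most `m = |F| / 2`
representing `f ^ p ^ t` multiply without reduction modulo `X ^ |F| - X`, so that a product of
powers of them is the monomial `X ^ m`. Hence each of them is a monomial, and the degrees are
determined by their sum. -/
theorem exists_eq_mul_pow_of_pow_card_half_sub {F : Type*} [Field F] [Fintype F] {p n : ℕ}
    [CharP F p] (hp : p.Prime) (h2 : p % 2 = 1) (hcard : Fintype.card F = p ^ n) {f : F → F}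
    (hf : Function.Injective f) (h0 : f 0 = 0)
    (h : ∀ x y, (f x - f y) ^ (Fintype.card F / 2) = (x - y) ^ (Fintype.card F / 2)) :
    ∃ a ≠ 0, ∃ j < n, ∀ x, f x = a * x ^ p ^ j := by
  have hq3 : 3 ≤ Fintype.card F := by
    have h1 := Fintype.one_lt_card (α := F)
    have h3 : p ^ n % 2 = 1 := by rw [Nat.pow_mod, h2]; simp
    omega
  have hn : n ≠ 0 := by
    rintro rfl
    simp at hcard
    omega
  have hodd : ∀ s, p ^ s % 2 = 1 := fun s => by rw [Nat.pow_mod, h2]; simp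
  set m := Fintype.card F / 2 with hm
  have hmq : m < Fintype.card F - 1 := by omega
  have hp3 : 3 ≤ p := by have := hp.two_le; omega
  have good : ∀ i, ¬ p ∣ (p ^ n / 2).choose i →
      ∃ R : F[X], R.natDegree ≤ m ∧ ∀ x, R.eval x = f x ^ i := by
    intro i hi
    refine exists_polynomial_eval_eq_pow hf h ?_
    rwa [Ne, CharP.cast_eq_zero_iff F p, hcard]
  -- the case `t = n` repeats `t = 0`, which closes the cycle of the degrees below
  have hR : ∀ t, ∃ R : F[X], t ≤ n → R.natDegree ≤ m ∧ ∀ x, R.eval x = f x ^ p ^ t := by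
    intro t
    rcases lt_trichotomy t n with ht | rfl | ht
    · obtain ⟨R, hR⟩ := good _ (Nat.not_dvd_choose_half_pow_pow hp h2 ht)
      exact ⟨R, fun _ => hR⟩
    · obtain ⟨R, hR⟩ := good _ (Nat.not_dvd_choose_half_pow_pow hp h2 (Nat.pos_of_ne_zero hn))
      refine ⟨R, fun _ => ⟨hR.1, fun x => ?_⟩⟩
      rw [hR.2, ← hcard, FiniteField.pow_card, pow_zero, pow_one]
    · exact ⟨0, fun h => absurd h (by omega)⟩
  choose R hR using hR
  have hhalf : ∀ s, p ^ (s + 1) / 2 = p ^ s / 2 + p / 2 * p ^ s := by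
    intro s
    have h1 := hodd s
    have h3 : p ^ (s + 1) = 2 * (p / 2 * p ^ s) + p ^ s := by
      rw [pow_succ]
      nth_rewrite 2 [(by omega : p = 2 * (p / 2) + 1)]
      ring
    omega
  have heval : ∀ s ≤ n, ∀ x, (∏ t ∈ Finset.range s, R t ^ (p / 2)).eval x
      = f x ^ (p ^ s / 2) := by
    intro s hs x
    induction s with
    | zero => simp
    | succ s ih =>
      rw [Finset.prod_range_succ, eval_mul, ih (by omega), eval_pow, (hR s (by omega)).2, hhalf,
        pow_add, ← pow_mul, mul_comm (p ^ s)]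
  -- a product of two polynomials of degree at most `m` has degree less than `|F|`, so it equals the
  -- polynomial of degree at most `m` which represents the same function
  have hdeg : ∀ s ≤ n, (∏ t ∈ Finset.range s, R t ^ (p / 2)).natDegree ≤ m := by
    intro s hs
    induction s with
    | zero => simp
    | succ s ih =>
      rw [Finset.prod_range_succ]
      suffices ∀ j ≤ p / 2,
          ((∏ t ∈ Finset.range s, R t ^ (p / 2)) * R s ^ j).natDegree ≤ m from this _ le_rfl
      intro j hj
      induction j with
      | zero => simpa using ih (by omega)
      | succ j ihj =>
        obtain ⟨Q, hQd, hQ⟩ := good _ (Nat.not_dvd_choose_half_pow_digits hp h2 (n := n) (s := s)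
          (j := j + 1) (by omega) hj)
        have : (∏ t ∈ Finset.range s, R t ^ (p / 2)) * R s ^ (j + 1) = Q := by
          refine eq_of_natDegree_lt_card_of_eval_eq_univ ?_ (by omega) fun x => ?_
          · rw [pow_succ, ← mul_assoc]
            have h1 := natDegree_mul_le (p := (∏ t ∈ Finset.range s, R t ^ (p / 2)) * R s ^ j)
              (q := R s)
            have h3 := ihj (by omega)
            have h4 := (hR s (by omega)).1
            have h5 : Fintype.card F % 2 = 1 := hcard ▸ hodd n
            omega
          · rw [eval_mul, heval s (by omega), eval_pow, (hR s (by omega)).2, hQ, pow_add _ _ (_ * _),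
              ← pow_mul, mul_comm (p ^ s)]
        rwa [this]
  have hprod : ∏ t ∈ Finset.range n, R t ^ (p / 2) = X ^ m := by
    refine eq_of_natDegree_lt_card_of_eval_eq_univ ?_ ?_ fun x => ?_
    · have := hdeg n le_rfl
      omega
    · rw [natDegree_X_pow]
      omega
    · have := h x 0
      rw [h0, sub_zero, sub_zero] at this
      rw [heval n le_rfl, eval_pow, eval_X, ← hcard, this]
  have hRn : R n = R 0 := by
    refine eq_of_natDegree_lt_card_of_eval_eq_univ ?_ ?_ fun x => ?_
    · have := (hR n le_rfl).1
      omega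
    · have := (hR 0 (by omega)).1
      omega
    · rw [(hR n le_rfl).2, (hR 0 (by omega)).2, ← hcard, FiniteField.pow_card, pow_zero, pow_one]
  have hmono : ∀ t ≤ n, ∃ c : F, R t = C c * X ^ (R t).natDegree := by
    have : ∀ t < n, ∃ c : F, R t = C c * X ^ (R t).natDegree := by
      intro t ht
      -- divisors of a power of `X` are monomials
      have hdvd : R t ∣ X ^ m := by
        rw [← hprod]
        exact (dvd_pow_self _ (by omega)).trans (Finset.dvd_prod_of_mem _ (Finset.mem_range.2 ht))
      obtain ⟨i, -, u, hu⟩ := (dvd_prime_pow prime_X _).1 hdvd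
      obtain ⟨c, hc, hcu⟩ := Polynomial.isUnit_iff.1 (u⁻¹).isUnit
      have hRt : R t = C c * X ^ i := by
        rw [hcu, ← hu, mul_comm, mul_assoc, Units.mul_inv, mul_one]
      refine ⟨c, ?_⟩
      rw [hRt, natDegree_C_mul_X_pow _ _ hc.ne_zero]
    intro t ht
    rcases ht.lt_or_eq with ht | rfl
    · exact this t ht
    · rw [hRn]
      exact this 0 (by omega)
  have hf1 : f 1 ≠ 0 := fun h1 => one_ne_zero (hf (h1.trans h0.symm))
  have hpow : ∀ t ≤ n, ∀ x, f x ^ p ^ t = f 1 ^ p ^ t * x ^ (R t).natDegree := by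
    intro t ht x
    obtain ⟨c, hc⟩ := hmono t ht
    have h1 := (hR t ht).2 1
    have hx := (hR t ht).2 x
    rw [hc] at h1 hx
    simp only [eval_mul, eval_C, eval_pow, eval_X, one_pow, mul_one] at h1 hx
    rw [← hx, h1]
  have hstep : ∀ t < n, (R (t + 1)).natDegree = p * (R t).natDegree % (p ^ n - 1) := by
    intro t ht
    obtain ⟨g, hg⟩ := IsCyclic.exists_generator (α := Fˣ)
    have hord : orderOf g = p ^ n - 1 := by
      rw [orderOf_eq_card_of_forall_mem_zpowers hg, Nat.card_units, Nat.card_eq_fintype_card,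
        hcard]
    have h1 := hpow (t + 1) ht g
    rw [pow_succ, pow_mul, pow_mul, hpow t ht.le g, mul_pow, mul_right_inj' (by positivity),
      ← pow_mul] at h1
    -- comparing the values at a generator of `Fˣ` gives the degrees modulo `|F| - 1`
    have h3 : g ^ ((R t).natDegree * p) = g ^ (R (t + 1)).natDegree := Units.ext (by simpa using h1)
    rw [pow_eq_pow_iff_modEq, hord, Nat.ModEq, mul_comm] at h3
    refine (h3.trans (Nat.mod_eq_of_lt ?_)).symm
    have := (hR (t + 1) ht).1
    omega
  have hsum : (p - 1) * ∑ t ∈ Finset.range n, (R t).natDegree = p ^ n - 1 := by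
    have h1 := congrArg natDegree hprod
    rw [natDegree_X_pow, natDegree_prod] at h1
    · simp only [natDegree_pow] at h1
      rw [← Finset.mul_sum] at h1
      have h3 : p - 1 = 2 * (p / 2) := by omega
      have h5 := hodd n
      rw [h3, mul_assoc, h1, hm, hcard]
      omega
    · intro t ht h3
      rw [Finset.prod_eq_zero ht h3] at hprod
      exact pow_ne_zero m X_ne_zero hprod.symm
  obtain ⟨j, hj, hdj⟩ := Nat.exists_eq_pow_of_cyclic_mul (d := fun t => (R t).natDegree)
    hp.two_le hn hstep (by rw [hRn]) hsum
  refine ⟨f 1, hf1, j, hj, fun x => ?_⟩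
  simpa [hdj] using hpow 0 (by omega) x

/-! ### Isomorphisms from the Paley graph to Cayley graphs of `F` -/

theorem card_filter_mul_pow_eq_self_le {F : Type*} [Field F] [Fintype F] [DecidableEq F] {N : ℕ}
    (hN : 1 < N) {a : F} (ha : a ≠ 0) : (Finset.univ.filter fun x : F => a * x ^ N = x).card ≤ N := by
  have hdeg : (C a * X ^ N - X : F[X]).natDegree = N := by
    rw [natDegree_sub_eq_left_of_natDegree_lt, natDegree_C_mul_X_pow _ _ ha]
    rwa [natDegree_C_mul_X_pow _ _ ha, natDegree_X]
  have hne : (C a * X ^ N - X : F[X]) ≠ 0 := by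
    intro h
    rw [h, natDegree_zero] at hdeg
    omega
  calc _ ≤ (C a * X ^ N - X : F[X]).roots.toFinset.card := by
        refine Finset.card_le_card fun x hx => ?_
        rw [Multiset.mem_toFinset, mem_roots hne]
        simpa [sub_eq_zero] using hx
    _ ≤ _ := (Multiset.toFinset_card_le _).trans ((card_roots' _).trans hdeg.le)

/-- A regular action of the additive group of `F` on `F` by semiaffine maps
`x ↦ a * x ^ p ^ j + b` consists of translations. If some `f c` involved a nontrivial power of
the Frobenius, then, `j` taking at most `n` values and the linear part of `f c` fixing few points,
the commutation of `f c` with all the `f d` would make the orbit of `0` too small. -/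
theorem eq_add_of_regular_semiaffine {F : Type*} [Field F] [Fintype F] {p n : ℕ}
    [CharP F p] (hp : p.Prime) (h2 : p % 2 = 1) (hcard : Fintype.card F = p ^ n) {f : F → F → F}
    (hadd : ∀ c d x, f (c + d) x = f c (f d x)) (hbij : Function.Bijective fun c => f c 0)
    {a : F → F} {j : F → ℕ} (ha : ∀ c, a c ≠ 0) (hj : ∀ c, j c < n)
    (hf : ∀ c x, f c x = a c * x ^ p ^ j c + f c 0) (c x : F) : f c x = x + f c 0 := by
  classical
  have : Fact p.Prime := ⟨hp⟩
  have hp3 : 3 ≤ p := by have := hp.two_le; omega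
  have hpos : ∀ t, p ^ t ≠ 0 := fun t => pow_ne_zero _ hp.ne_zero
  -- the linear part of `f c`
  obtain ⟨A, hA⟩ : ∃ A : F → F → F, ∀ c x, A c x = a c * x ^ p ^ j c := ⟨_, fun _ _ => rfl⟩
  have hfA : ∀ c x, f c x = A c x + f c 0 := fun c x => by rw [hA, ← hf]
  have hAadd : ∀ c x y, A c (x + y) = A c x + A c y := fun c x y => by
    rw [hA, hA, hA, add_pow_char_pow, mul_add]
  have hAmul : ∀ c d x, A (c + d) x = A c (A d x) := by
    intro c d x
    have h1 := hadd c d x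
    have h3 := hadd c d 0
    rw [hfA (c + d), hfA d, hfA c, hAadd] at h1
    rw [hfA c (f d 0)] at h3
    rw [h3] at h1
    linear_combination h1
  have hAone : ∀ x, A 0 x = x := by
    have h1 : ∀ x, f 0 x = x := by
      intro x
      obtain ⟨d, rfl⟩ := hbij.2 x
      simpa using (hadd 0 d 0).symm
    intro x
    have := hfA 0 x
    rw [h1, h1, add_zero] at this
    exact this.symm
  -- `A e` has order dividing `p`, and `1` is the only `p`-th root of unity in `F`
  have hscalar : ∀ e r, (∀ x, A e x = r * x) → r = 1 := by
    intro e r hr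
    have hk : ∀ k : ℕ, ∀ x, A (k • e) x = r ^ k * x := by
      intro k
      induction k with
      | zero => simpa using hAone
      | succ k ih =>
        intro x
        rw [succ_nsmul, hAmul, hr, ih]
        ring
    have h1 := hk p 1
    rw [nsmul_eq_mul, CharP.cast_eq_zero, zero_mul, hAone, mul_one] at h1
    apply frobenius_inj F p
    rw [frobenius_def, map_one, h1]
  -- `A d` and `A d'` with the same power of the Frobenius differ by a scalar
  have hjinj : ∀ d d', j d = j d' → ∀ x, A d x = A d' x := by
    intro d d' hdd x
    have h1 : ∀ y, A (d - d') y = (a d / a d') * y := by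
      intro y
      have h3 : A d' (A (-d') y) = y := by rw [← hAmul, add_neg_cancel, hAone]
      have h4 : A (d - d') (A d' (A (-d') y)) = A d (A (-d') y) := by
        rw [← hAmul (d - d') d', sub_add_cancel]
      rw [h3] at h4
      rw [h4, hA d, hdd]
      nth_rewrite 2 [← h3]
      rw [hA d']
      field_simp [ha d']
    have h3 : a d = a d' := by
      rw [← div_eq_one_iff_eq (ha d')]
      exact hscalar _ _ h1
    rw [hA, hA, hdd, h3]
  have hcomm : ∀ c d, A c (f d 0) - f d 0 = A d (f c 0) - f c 0 := by
    intro c d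
    have h1 := hadd c d 0
    rw [add_comm, hadd d c, hfA d (f c 0), hfA c (f d 0)] at h1
    linear_combination -h1
  have hjc : ∀ c, j c = 0 := by
    intro c
    by_contra hjc
    have hjn := hj c
    -- by `hcomm`, the points `f d 0` with a given value of `j d` differ by fixed points of `A c`
    have hbound : Fintype.card F ≤ (Finset.univ.filter fun x => A c x = x).card * n := by
      have := Finset.card_le_mul_card_image_of_maps_to (f := j) (s := Finset.univ)
        (t := Finset.range n) (fun d _ => Finset.mem_range.2 (hj d))
        (Finset.univ.filter fun x => A c x = x).card (fun i _ => ?_)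
      · rwa [Finset.card_range] at this
      · rcases (Finset.univ.filter fun d => j d = i).eq_empty_or_nonempty with he | ⟨d', hd'⟩
        · rw [he]
          simp
        · refine Finset.card_le_card_of_injOn (fun d => f d 0 - f d' 0) (fun d hd => ?_)
            fun d _ e _ hde => hbij.1 (sub_left_inj.1 hde)
          simp only [Finset.coe_filter, Finset.mem_univ, true_and, Set.mem_ofPred_eq,
            Finset.mem_filter] at hd hd' ⊢
          have h1 := hAadd c (f d 0 - f d' 0) (f d' 0)
          rw [sub_add_cancel] at h1
          have h3 := hcomm c d
          have h4 := hcomm c d'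
          rw [hjinj d d' (hd.trans hd'.symm)] at h3
          linear_combination h3 - h4 - h1
    have hker : (Finset.univ.filter fun x => A c x = x).card ≤ p ^ j c := by
      simp only [hA]
      exact card_filter_mul_pow_eq_self_le (Nat.one_lt_pow hjc hp.one_lt) (ha c)
    -- raising `A c x = x` to a power reverses the roles of `j c` and `n - j c`
    have hker' : (Finset.univ.filter fun x => A c x = x).card ≤ p ^ (n - j c) := by
      refine le_trans (Finset.card_le_card fun x hx => ?_) (card_filter_mul_pow_eq_self_le
        (Nat.one_lt_pow (by omega : n - j c ≠ 0) hp.one_lt)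
        (inv_ne_zero (pow_ne_zero (p ^ (n - j c)) (ha c))))
      simp only [Finset.mem_filter, Finset.mem_univ, true_and, hA] at hx ⊢
      have h1 : (a c * x ^ p ^ j c) ^ p ^ (n - j c) = x ^ p ^ (n - j c) := by rw [hx]
      rw [mul_pow, ← pow_mul, ← pow_add, Nat.add_sub_cancel' hjn.le, ← hcard,
        FiniteField.pow_card] at h1
      rw [← h1, inv_mul_cancel_left₀ (pow_ne_zero _ (ha c))]
    -- `p ^ j c` and `p ^ (n - j c)` are both at most `n`, which this estimate excludes
    have hlin : ∀ u, 2 * u + 1 ≤ p ^ u := by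
      intro u
      induction u with
      | zero => simp
      | succ u ih =>
        rw [pow_succ]
        nlinarith
    have hsplit : p ^ n = p ^ j c * p ^ (n - j c) := by
      rw [← pow_add, Nat.add_sub_cancel' hjn.le]
    have h1 : p ^ (n - j c) ≤ n := by
      refine Nat.le_of_mul_le_mul_left ?_ (Nat.pos_of_ne_zero (hpos (j c)))
      rw [← hsplit, ← hcard]
      exact hbound.trans (Nat.mul_le_mul_right _ hker)
    have h3 : p ^ j c ≤ n := by
      refine Nat.le_of_mul_le_mul_left ?_ (Nat.pos_of_ne_zero (hpos (n - j c)))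
      rw [mul_comm, ← hsplit, ← hcard]
      exact hbound.trans (Nat.mul_le_mul_right _ hker')
    have h4 := hlin (j c)
    have h5 := hlin (n - j c)
    omega
  have hac : ∀ x, A c x = a c * x := fun x => by rw [hA, hjc, pow_zero, pow_one]
  rw [hfA, hac, hscalar c _ hac, one_mul]

theorem mem_quadraticResidues_iff_pow {F : Type*} [Field F] [Fintype F]
    (hF : Fintype.card F % 2 = 1) {x : F} :
    x ∈ quadraticResidues F ↔ x ^ (Fintype.card F / 2) = 1 := by
  have hchar : ringChar F ≠ 2 := fun h => by
    have := FiniteField.even_card_of_char_two h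
    omega
  have hpos : Fintype.card F / 2 ≠ 0 := by
    have := Fintype.one_lt_card (α := F)
    omega
  rcases eq_or_ne x 0 with rfl | hx
  · simp [quadraticResidues, zero_pow hpos]
  · rw [← FiniteField.isSquare_iff hchar hx]
    constructor
    · rintro ⟨y, -, rfl⟩
      exact ⟨y, sq y⟩
    · rintro ⟨y, rfl⟩
      exact ⟨y, left_ne_zero_of_mul hx, sq y⟩

/-- An isomorphism between the Paley graph and a Cayley graph of the additive group of `F` is
affine: it transports the translations of the target to a regular group of automorphisms of the
Paley graph, which by Carlitz's theorem consists of semiaffine maps. -/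
theorem Equiv.map_add_of_sub_mem_iff_quadraticResidues {F : Type*} [Field F] [Finite F]
    (hF : Nat.card F % 2 = 1) {T : Set F} (φ : F ≃ F) (h0 : φ 0 = 0)
    (h : ∀ x y, φ x - φ y ∈ T ↔ x - y ∈ quadraticResidues F) (x y : F) :
    φ (x + y) = φ x + φ y := by
  have := Fintype.ofFinite F
  rw [Nat.card_eq_fintype_card] at hF
  obtain ⟨p, hchar⟩ := CharP.exists F
  obtain ⟨n, hp, hcard⟩ := FiniteField.card F p
  have h2 : p % 2 = 1 := by
    by_contra h2
    have : p ^ (n : ℕ) % 2 = 0 := by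
      rw [Nat.pow_mod, (by omega : p % 2 = 0), zero_pow n.ne_zero]
      rfl
    omega
  have hringChar : ringChar F ≠ 2 := fun h => by
    have := FiniteField.even_card_of_char_two h
    omega
  -- the translations of the target, transported to the source
  obtain ⟨f, hf⟩ : ∃ f : F → F → F, ∀ c x, f c x = φ.symm (c + φ x) := ⟨_, fun _ _ => rfl⟩
  have hinj : ∀ c, Function.Injective (f c) := by
    intro c x y hxy
    simpa [hf] using hxy
  have hres : ∀ c x y, f c x - f c y ∈ quadraticResidues F ↔ x - y ∈ quadraticResidues F := by
    intro c x y
    rw [← h, ← h, hf, hf, φ.apply_symm_apply, φ.apply_symm_apply, add_sub_add_left_eq_sub]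
  have hpow : ∀ c x y,
      (f c x - f c y) ^ (Fintype.card F / 2) = (x - y) ^ (Fintype.card F / 2) := by
    intro c x y
    rcases eq_or_ne x y with rfl | hxy
    · simp
    · have h1 := hres c x y
      rw [mem_quadraticResidues_iff_pow hF, mem_quadraticResidues_iff_pow hF] at h1
      rcases FiniteField.pow_dichotomy hringChar (sub_ne_zero.2 hxy) with h3 | h3
      · rw [h3, h1.2 h3]
      · rcases FiniteField.pow_dichotomy hringChar (sub_ne_zero.2 ((hinj c).ne hxy)) with h4 | h4
        · rw [h4, h1.1 h4]
        · rw [h3, h4]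
  have hform : ∀ c, ∃ a ≠ 0, ∃ j < (n : ℕ), ∀ x, f c x - f c 0 = a * x ^ p ^ j := fun c =>
    exists_eq_mul_pow_of_pow_card_half_sub hp h2 hcard (f := fun x => f c x - f c 0)
      (fun x y hxy => hinj c (sub_left_inj.1 hxy)) (sub_self _)
      (fun x y => by rw [sub_sub_sub_cancel_right, hpow])
  choose a ha j hj haj using hform
  have key := eq_add_of_regular_semiaffine hp h2 hcard (f := f)
    (fun c d x => by simp [hf, add_assoc])
    (by simp [hf, h0]) ha hj
    (fun c x => by rw [← haj, sub_add_cancel]) (φ y) x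
  rw [hf, hf, h0, add_zero, φ.symm_apply_apply] at key
  rw [← key, φ.apply_symm_apply, add_comm]

/-! ### Automorphisms of prime order of connected graphs of small degree -/

/-- An automorphism of prime order `ℓ` which fixes a vertex of a connected graph fixes its
neighbors, if there are fewer than `ℓ` of them, and so on. -/
theorem SimpleGraph.Preconnected.iso_eq_one_of_pow_eq_one {V : Type*} [Finite V]
    {Γ : SimpleGraph V} (hΓ : Γ.Preconnected) {ℓ : ℕ} (hℓ : ℓ.Prime)
    (hdeg : ∀ v, (Γ.neighborSet v).ncard < ℓ) {σ : Γ ≃g Γ} (hσ : σ ^ ℓ = 1) {v : V}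
    (hv : σ v = v) : σ = 1 := by
  have hiter : ∀ (k : ℕ) (w : V), σ^[k] w = (σ ^ k) w := by
    intro k
    induction k with
    | zero => exact fun _ => rfl
    | succ k ih =>
      intro w
      rw [Function.iterate_succ_apply, ih, pow_succ]
      rfl
  have hstep : ∀ u w, σ u = u → Γ.Adj u w → σ w = w := by
    intro u w hu huw
    have hper : Function.IsPeriodicPt σ ℓ w := by
      rw [Function.IsPeriodicPt, Function.IsFixedPt, hiter, hσ]
      rfl
    rcases (Nat.dvd_prime hℓ).1 hper.minimalPeriod_dvd with h1 | h1
    · exact Function.minimalPeriod_eq_one_iff_isFixedPt.1 h1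
    · exfalso
      -- the orbit of `w` would consist of `ℓ` neighbors of `u`
      have hmem : ∀ k : ℕ, σ^[k] w ∈ Γ.neighborSet u := by
        intro k
        induction k with
        | zero => exact huw
        | succ k ih =>
          rw [Function.iterate_succ_apply', SimpleGraph.mem_neighborSet]
          nth_rewrite 1 [← hu]
          exact σ.map_adj_iff.2 ih
      have hle : (Set.Iio ℓ).ncard ≤ (Γ.neighborSet u).ncard :=
        Set.ncard_le_ncard_of_injOn (fun k => σ^[k] w) (fun k _ => hmem k)
          (by simpa [h1] using Function.iterate_injOn_Iio_minimalPeriod (f := σ) (x := w))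
          (Set.toFinite _)
      rw [Set.ncard_Iio_nat] at hle
      exact absurd (hdeg u) (not_lt.2 hle)
  refine RelIso.ext fun w => ?_
  obtain ⟨W⟩ := hΓ v w
  induction W with
  | nil => exact hv
  | cons huw _ ih => exact ih (hstep _ _ hv huw)

/-- If `ℓ ^ 2` does not divide the number of vertices of a connected vertex-transitive graph of
degree less than `ℓ`, then the subgroups of order `ℓ` of its automorphism group are Sylow
subgroups. Thus, an isomorphism between two such graphs can be modified so as to match given
automorphisms of order `ℓ`, up to a power. -/
theorem SimpleGraph.Preconnected.exists_iso_map_eq_pow {V V' : Type*} [Finite V]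
    {Γ : SimpleGraph V} {Γ' : SimpleGraph V'} (hΓ : Γ.Preconnected) {ℓ : ℕ} (hℓ : ℓ.Prime)
    (hdeg : ∀ v, (Γ.neighborSet v).ncard < ℓ) (htrans : ∀ v w, ∃ σ : Γ ≃g Γ, σ v = w)
    (hcard : ¬ ℓ ^ 2 ∣ Nat.card V) (φ : Γ ≃g Γ') {τ : Γ ≃g Γ} {τ' : Γ' ≃g Γ'}
    (hτ : orderOf τ = ℓ) (hτ' : orderOf τ' = ℓ) :
    ∃ (ψ : Γ ≃g Γ') (k : ℕ), ∀ v, ψ (τ v) = (τ' ^ k) (ψ v) := by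
  have := Fact.mk hℓ
  have hfin : Finite (Γ ≃g Γ) := Finite.of_injective _ RelIso.toEquiv_injective
  obtain ⟨ρ, hρ⟩ : ∃ ρ : Γ ≃g Γ, ∀ v, ρ v = φ.symm (τ' (φ v)) :=
    ⟨(φ.trans τ').trans φ.symm, fun _ => rfl⟩
  have hρpow : ∀ (k : ℕ) (v : V), φ ((ρ ^ k) v) = (τ' ^ k) (φ v) := by
    intro k
    induction k with
    | zero => exact fun _ => rfl
    | succ k ih =>
      intro v
      rw [pow_succ, pow_succ, RelIso.mul_apply, RelIso.mul_apply, ih, hρ, φ.apply_symm_apply]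
  have hρord : orderOf ρ = ℓ := by
    refine orderOf_eq_prime (RelIso.ext fun v => φ.injective ?_) fun h1 => ?_
    · rw [hρpow, ← hτ', pow_orderOf_eq_one]
      rfl
    · have h3 : τ' = 1 := by
        refine RelIso.ext fun v => ?_
        obtain ⟨v, rfl⟩ := φ.surjective v
        have := hρpow 1 v
        rw [pow_one, pow_one, h1] at this
        exact this.symm
      rw [h3, orderOf_one] at hτ'
      exact hℓ.one_lt.ne hτ'
  have hne : Nonempty V := by
    by_contra hV
    rw [not_nonempty_iff] at hV
    have : τ = 1 := RelIso.ext fun v => hV.elim v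
    rw [this, orderOf_one] at hτ
    exact hℓ.one_lt.ne hτ
  obtain ⟨v⟩ := hne
  have hpre : MulAction.IsPretransitive (Γ ≃g Γ) V := ⟨htrans⟩
  have hstab : ¬ ℓ ∣ Nat.card (MulAction.stabilizer (Γ ≃g Γ) v) := by
    intro hdvd
    obtain ⟨⟨g, hg⟩, hord⟩ := exists_prime_orderOf_dvd_card' ℓ hdvd
    have h1 : g ^ ℓ = 1 := by
      rw [← hord, Subgroup.orderOf_mk]
      exact pow_orderOf_eq_one g
    have h3 := hΓ.iso_eq_one_of_pow_eq_one hℓ hdeg h1 (v := v) hg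
    rw [Subgroup.orderOf_mk, h3, orderOf_one] at hord
    exact hℓ.one_lt.ne hord
  have hsylow : ∀ σ : Γ ≃g Γ, orderOf σ = ℓ → ¬ ℓ ∣ (Subgroup.zpowers σ).index := by
    rintro σ hσ ⟨r, hr⟩
    have h1 := (Subgroup.zpowers σ).card_mul_index
    rw [← (MulAction.stabilizer (Γ ≃g Γ) v).card_mul_index,
      MulAction.index_stabilizer_of_transitive, Nat.card_zpowers, hσ, hr] at h1
    refine hcard (Nat.Coprime.dvd_of_dvd_mul_left
      (Nat.Coprime.pow_left 2 ((Nat.Prime.coprime_iff_not_dvd hℓ).2 hstab)) ?_)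
    exact ⟨r, by rw [← h1]; ring⟩
  have hpgroup : ∀ σ : Γ ≃g Γ, orderOf σ = ℓ → IsPGroup ℓ (Subgroup.zpowers σ) := fun σ hσ =>
    IsPGroup.of_card (n := 1) (by rw [Nat.card_zpowers, hσ, pow_one])
  obtain ⟨g, hg⟩ := MulAction.exists_smul_eq (Γ ≃g Γ)
    ((hpgroup τ hτ).toSylow (hsylow τ hτ)) ((hpgroup ρ hρord).toSylow (hsylow ρ hρord))
  have hmem : g * τ * g⁻¹ ∈ Subgroup.zpowers ρ := by
    rw [← IsPGroup.mem_toSylow (hpgroup ρ hρord) (hsylow ρ hρord), ← hg]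
    exact Subgroup.smul_mem_pointwise_smul τ (MulAut.conj g) _ (Subgroup.mem_zpowers τ)
  rw [← mem_powers_iff_mem_zpowers] at hmem
  obtain ⟨k, hk⟩ := hmem
  refine ⟨g.trans φ, k, fun w => ?_⟩
  have h1 : g (τ w) = (ρ ^ k) (g w) := by
    have : ρ ^ k * g = g * τ := by
      simp only at hk
      rw [hk, inv_mul_cancel_right]
    rw [← RelIso.mul_apply, ← RelIso.mul_apply, this]
  change φ (g (τ w)) = (τ' ^ k) (φ (g w))
  rw [h1, hρpow]

/-! ### Cayley graphs -/

theorem SimpleGraph.addCayley_adj_iff_sub_mem {G : Type*} [AddCommGroup G] {S : Set G}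
    (h0 : (0 : G) ∉ S) (hneg : ∀ s ∈ S, -s ∈ S) {u v : G} :
    (SimpleGraph.addCayley S).Adj u v ↔ v - u ∈ S := by
  rw [SimpleGraph.addCayley_adj, neg_add_eq_sub, neg_add_eq_sub]
  constructor
  · rintro ⟨-, h | h⟩
    · exact h
    · simpa using hneg _ h
  · refine fun h => ⟨?_, Or.inl h⟩
    rintro rfl
    exact h0 (by simpa using h)

/-- The translation by `d`, as an automorphism of a Cayley graph. -/
def SimpleGraph.addCayleyTranslation {G : Type*} [AddGroup G] (S : Set G) (d : G) :
    SimpleGraph.addCayley S ≃g SimpleGraph.addCayley S where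
  toEquiv := Equiv.addLeft d
  map_rel_iff' := by simp

theorem SimpleGraph.addCayleyTranslation_pow_apply {G : Type*} [AddGroup G] (S : Set G) (d : G)
    (k : ℕ) (v : G) : (addCayleyTranslation S d ^ k) v = k • d + v := by
  induction k generalizing v with
  | zero => simp
  | succ k ih =>
    rw [pow_succ, RelIso.mul_apply, ih, succ_nsmul, add_assoc]
    rfl

theorem SimpleGraph.orderOf_addCayleyTranslation {G : Type*} [AddGroup G] (S : Set G) (d : G) :
    orderOf (addCayleyTranslation S d) = addOrderOf d := by
  refine Nat.dvd_antisymm (orderOf_dvd_of_pow_eq_one (RelIso.ext fun v => ?_))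
    (addOrderOf_dvd_of_nsmul_eq_zero ?_)
  · rw [addCayleyTranslation_pow_apply, addOrderOf_nsmul_eq_zero, zero_add]
    rfl
  · have := addCayleyTranslation_pow_apply S d (orderOf (addCayleyTranslation S d)) 0
    rw [pow_orderOf_eq_one, add_zero] at this
    exact this.symm

theorem SimpleGraph.addCayley_preconnected {G : Type*} [AddCommGroup G] {S : Set G}
    (h : AddSubgroup.closure S = ⊤) : (SimpleGraph.addCayley S).Preconnected := by
  have key : ∀ g : G, ∀ v, (SimpleGraph.addCayley S).Reachable v (v + g) := by
    intro g
    have hg : g ∈ AddSubgroup.closure S := h ▸ AddSubgroup.mem_top g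
    induction hg using AddSubgroup.closure_induction with
    | mem s hs =>
      intro v
      rcases eq_or_ne s 0 with rfl | h0
      · rw [add_zero]
      · refine SimpleGraph.Adj.reachable ?_
        rw [SimpleGraph.addCayley_adj]
        exact ⟨by simpa using h0, Or.inl (by simpa using hs)⟩
    | zero => exact fun v => by rw [add_zero]
    | add a b _ _ ha hb => exact fun v => (ha v).trans (by rw [← add_assoc]; exact hb _)
    | neg a _ ha => exact fun v => by simpa using (ha (v + -a)).symm
  intro u v
  simpa using key (v - u) u

/-! ### Quadratic residues and voltage sets -/

theorem ncard_quadraticResidues_le {F : Type*} [Field F] [Finite F] (hF : Nat.card F % 2 = 1) :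
    (quadraticResidues F).ncard ≤ Nat.card F / 2 := by
  classical
  have := Fintype.ofFinite F
  rw [Nat.card_eq_fintype_card] at hF ⊢
  have hpos : 0 < Fintype.card F / 2 := by
    have := Fintype.one_lt_card (α := F)
    omega
  have hsub : quadraticResidues F ⊆
      ((Polynomial.nthRoots (Fintype.card F / 2) (1 : F)).toFinset : Set F) := by
    intro x hx
    rw [Finset.mem_coe, Multiset.mem_toFinset, Polynomial.mem_nthRoots hpos]
    exact (mem_quadraticResidues_iff_pow hF).1 hx
  refine (Set.ncard_le_ncard hsub (Finset.finite_toSet _)).trans ?_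
  rw [Set.ncard_coe_finset]
  exact (Multiset.toFinset_card_le _).trans (Polynomial.card_nthRoots _ _)

theorem closure_quadraticResidues {F : Type*} [Field F] (h2 : (2 : F) ≠ 0) :
    AddSubgroup.closure (quadraticResidues F) = ⊤ := by
  refine (AddSubgroup.eq_top_iff' _).2 fun x => ?_
  have hsq : ∀ y : F, y ^ 2 ∈ AddSubgroup.closure (quadraticResidues F) := by
    intro y
    rcases eq_or_ne y 0 with rfl | hy
    · simp
    · exact AddSubgroup.subset_closure ⟨y, hy, rfl⟩
  have : x = ((x + 1) / 2) ^ 2 - ((x - 1) / 2) ^ 2 := by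
    field_simp
    ring
  rw [this]
  exact AddSubgroup.sub_mem _ (hsq _) (hsq _)

theorem mem_voltageSet {F : Type*} [Field F] {ℓ : ℕ} {α : quadraticResidues F → ZMod ℓ} {x : F}
    {z : ZMod ℓ} : (x, z) ∈ voltageSet α ↔ ∃ h : x ∈ quadraticResidues F, z = α ⟨x, h⟩ := by
  constructor
  · rintro ⟨⟨s, hs⟩, h⟩
    obtain ⟨h1, h3⟩ := Prod.mk.inj h
    subst h1
    exact ⟨hs, h3⟩
  · rintro ⟨h, rfl⟩
    exact ⟨⟨x, h⟩, rfl⟩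

theorem zero_notMem_voltageSet {F : Type*} [Field F] {ℓ : ℕ} (α : quadraticResidues F → ZMod ℓ) :
    (0 : F × ZMod ℓ) ∉ voltageSet α := by
  rintro ⟨⟨s, x, hx, rfl⟩, h⟩
  exact pow_ne_zero 2 hx (Prod.ext_iff.1 h).1.symm

theorem neg_mem_quadraticResidues {F : Type*} [Field F] (h : IsSquare (-1 : F)) {s : F}
    (hs : s ∈ quadraticResidues F) : -s ∈ quadraticResidues F := by
  obtain ⟨i, hi⟩ := h
  obtain ⟨x, hx, rfl⟩ := hs
  refine ⟨i * x, mul_ne_zero ?_ hx, by rw [mul_pow, sq i, ← hi, neg_one_mul]⟩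
  rintro rfl
  simp at hi

theorem IsVoltageAssignment.neg_mem_voltageSet {F : Type*} [Field F] {ℓ : ℕ}
    {α : quadraticResidues F → ZMod ℓ} (hα : IsVoltageAssignment α) (h : IsSquare (-1 : F)) :
    ∀ s ∈ voltageSet α, -s ∈ voltageSet α := by
  rintro _ ⟨s, rfl⟩
  exact ⟨⟨-s, neg_mem_quadraticResidues h s.2⟩,
    Prod.ext rfl (hα.map_neg s ⟨-s, neg_mem_quadraticResidues h s.2⟩ rfl).symm⟩

/-- A multiple by `p` of `(s, α s)` is a generator of the subgroup `0 × ℤ/ℓ` if `α s ≠ 0`. -/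
theorem IsVoltageAssignment.closure_voltageSet {F : Type*} [Field F] {p ℓ : ℕ} [CharP F p]
    (h2 : (2 : F) ≠ 0) [Fact ℓ.Prime] (hp : (p : ZMod ℓ) ≠ 0)
    {α : quadraticResidues F → ZMod ℓ} (hα : IsVoltageAssignment α) :
    AddSubgroup.closure (voltageSet α) = ⊤ := by
  set H := AddSubgroup.closure (voltageSet α) with hH
  have hsub : ∀ s : quadraticResidues F, ((s : F), α s) ∈ H := fun s =>
    AddSubgroup.subset_closure ⟨s, rfl⟩
  have hfiber : ∀ z : ZMod ℓ, ((0 : F), z) ∈ H := by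
    intro z
    obtain ⟨s, hs⟩ := hα.exists_ne_zero
    have h1 := H.nsmul_mem (hsub s) ((z / (p * α s)).val * p)
    have h3 : ((z / (p * α s)).val * p) • ((s : F), α s) = ((0 : F), z) := by
      refine Prod.ext ?_ ?_
      · simp [mul_smul]
      · simp only [Prod.smul_mk, nsmul_eq_mul, Nat.cast_mul, ZMod.natCast_val, ZMod.cast_id', id]
        field_simp
    rwa [h3] at h1
  have hbase : ∀ x : F, (x, (0 : ZMod ℓ)) ∈ H := by
    intro x
    have hle : AddSubgroup.closure (quadraticResidues F) ≤
        H.comap (AddMonoidHom.inl F (ZMod ℓ)) := by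
      rw [AddSubgroup.closure_le]
      intro s hs
      have := H.add_mem (hsub ⟨s, hs⟩) (hfiber (-α ⟨s, hs⟩))
      simpa using this
    rw [closure_quadraticResidues h2] at hle
    exact hle (AddSubgroup.mem_top x)
  refine (AddSubgroup.eq_top_iff' _).2 fun g => ?_
  simpa using H.add_mem (hbase g.1) (hfiber g.2)

/-- A bijection which maps differences in a voltage set to differences in `T` and commutes, up to
a constant `c`, with the translations of the fibers `ℤ/ℓ` is a group automorphism: on the base it
induces an isomorphism from the Paley graph to a Cayley graph, so that it is additive there, and
the part along the fibers is then a homomorphism from `F` to `ℤ/ℓ`. -/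
theorem exists_addEquiv_image_voltageSet_eq {F : Type*} [Field F] [Finite F] {ℓ : ℕ}
    (hF : Nat.card F % 2 = 1) (h2 : (2 : F) ≠ 0) [Fact ℓ.Prime]
    {α : quadraticResidues F → ZMod ℓ} {T : Set (F × ZMod ℓ)} (ψ : F × ZMod ℓ ≃ F × ZMod ℓ)
    (h0 : ψ 0 = 0) (h : ∀ u v, ψ v - ψ u ∈ T ↔ v - u ∈ voltageSet α) {c : ZMod ℓ}
    (hc : ∀ x z, ψ (x, z) = ψ (x, 0) + (0, c * z)) :
    ∃ f : F × ZMod ℓ ≃+ F × ZMod ℓ, f '' voltageSet α = T := by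
  obtain ⟨φ, hφ⟩ : ∃ φ : F → F, ∀ x, φ x = (ψ (x, 0)).1 := ⟨_, fun _ => rfl⟩
  obtain ⟨β, hβ⟩ : ∃ β : F → ZMod ℓ, ∀ x, β x = (ψ (x, 0)).2 := ⟨_, fun _ => rfl⟩
  have hψ : ∀ x z, ψ (x, z) = (φ x, β x + c * z) := by
    intro x z
    rw [hc, hφ, hβ]
    simp [Prod.ext_iff]
  have hφ0 : φ 0 = 0 := by
    rw [hφ]
    exact congrArg Prod.fst h0
  have hβ0 : β 0 = 0 := by
    rw [hβ]
    exact congrArg Prod.snd h0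
  have hc0 : c ≠ 0 := by
    rintro rfl
    have : ψ (0, 1) = ψ (0, 0) := by simp [hψ]
    exact one_ne_zero (Prod.ext_iff.1 (ψ.injective this)).2
  have hφsurj : Function.Surjective φ := by
    intro y
    obtain ⟨⟨x, z⟩, hxz⟩ := ψ.surjective (y, 0)
    rw [hψ] at hxz
    exact ⟨x, (Prod.ext_iff.1 hxz).1⟩
  let φe : F ≃ F := Equiv.ofBijective φ (Finite.surjective_iff_bijective.1 hφsurj)
  -- a difference in `T` determines its counterpart in the voltage set
  have hT : ∀ x y z', (φ x - φ y, z') ∈ T ↔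
      (x - y, (z' - (β x - β y)) / c) ∈ voltageSet α := by
    intro x y z'
    have := h (y, 0) (x, (z' - (β x - β y)) / c)
    rw [hψ, hψ, mul_div_cancel₀ _ hc0] at this
    simp only [Prod.mk_sub_mk, mul_zero, add_zero, sub_zero] at this
    rw [← this]
    congr! 2
    ring
  have hφadd : ∀ x y, φ (x + y) = φ x + φ y := by
    refine φe.map_add_of_sub_mem_iff_quadraticResidues hF (T := Prod.fst '' T) hφ0 fun x y => ?_
    constructor
    · rintro ⟨⟨_, z'⟩, hz', rfl⟩
      exact (mem_voltageSet.1 ((hT x y z').1 hz')).1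
    · intro hxy
      refine ⟨(φ x - φ y, c * α ⟨x - y, hxy⟩ + (β x - β y)), (hT x y _).2 ?_, rfl⟩
      rw [add_sub_cancel_right, mul_div_cancel_left₀ _ hc0]
      exact mem_voltageSet.2 ⟨hxy, rfl⟩
  have hβadd : ∀ y x, β (x + y) = β x + β y := by
    intro y
    have hy : y ∈ AddSubgroup.closure (quadraticResidues F) :=
      closure_quadraticResidues h2 ▸ AddSubgroup.mem_top y
    induction hy using AddSubgroup.closure_induction with
    | mem s hs =>
      intro x
      have h1 : (φ s - φ 0, c * α ⟨s, hs⟩ + β s) ∈ T := by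
        rw [hT, hβ0, sub_zero, sub_zero, add_sub_cancel_right, mul_div_cancel_left₀ _ hc0]
        exact mem_voltageSet.2 ⟨hs, rfl⟩
      have h3 : φ s - φ 0 = φ (x + s) - φ x := by
        rw [hφadd, hφ0, sub_zero, add_sub_cancel_left]
      rw [h3, hT, add_sub_cancel_left] at h1
      obtain ⟨_, h4⟩ := mem_voltageSet.1 h1
      rw [div_eq_iff hc0] at h4
      linear_combination -h4
    | zero => exact fun x => by rw [add_zero, hβ0, add_zero]
    | add a b _ _ ha hb => exact fun x => by rw [← add_assoc, hb, ha, hb, add_assoc]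
    | neg a _ ha =>
      intro x
      have h1 := ha (x + -a)
      have h3 := ha (-a)
      rw [neg_add_cancel_right] at h1
      rw [neg_add_cancel, hβ0] at h3
      linear_combination h3 - h1
  refine ⟨{ ψ with map_add' := fun u v => ?_ }, ?_⟩
  · change ψ (u.1 + v.1, u.2 + v.2) = ψ (u.1, u.2) + ψ (v.1, v.2)
    rw [hψ, hψ, hψ, hφadd, hβadd, Prod.mk_add_mk]
    congr 1
    ring
  · change ψ '' voltageSet α = T
    ext t
    obtain ⟨v, rfl⟩ := ψ.surjective t
    have := h 0 v
    rw [h0, sub_zero, sub_zero] at this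
    rw [this, ψ.injective.mem_set_image]

theorem mainTheorem4 {F : Type*} [Field F] [Finite F] (p : ℕ) [CharP F p]
    (hq : Nat.card F % 4 = 1) (ℓ : ℕ) (hℓ : ℓ.Prime) (hℓp : ℓ ≠ p)
    (hℓq : (Nat.card F - 1) / 2 < ℓ)
    (α : quadraticResidues F → ZMod ℓ) (hα : IsVoltageAssignment α) :
    IsCISubset (voltageSet α) := by
  have := Fact.mk hℓ
  have := Fintype.ofFinite F
  have hF : Nat.card F % 2 = 1 := by omega
  obtain ⟨n, hp, hcard⟩ := FiniteField.card F p
  rw [← Nat.card_eq_fintype_card] at hcard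
  have h2 : (2 : F) ≠ 0 := by
    refine Ring.two_ne_zero fun h => ?_
    have := FiniteField.even_card_of_char_two h
    rw [Nat.card_eq_fintype_card] at hF
    omega
  have hpℓ : (p : ZMod ℓ) ≠ 0 := by
    rw [Ne, ZMod.natCast_eq_zero_iff, Nat.prime_dvd_prime_iff_eq hℓ hp]
    exact hℓp
  -- this is where `q ≡ 1 (mod 4)` is needed
  have hneg1 : IsSquare (-1 : F) := by
    rw [FiniteField.isSquare_neg_one_iff, ← Nat.card_eq_fintype_card]
    omega
  have hS0 := zero_notMem_voltageSet α
  have hSneg := hα.neg_mem_voltageSet hneg1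
  have hclosure := hα.closure_voltageSet h2 hpℓ
  refine ⟨hS0, hSneg, hclosure, ?_⟩
  rintro T hT0 hTneg ⟨φ⟩
  have hdeg : ∀ v, ((SimpleGraph.addCayley (voltageSet α)).neighborSet v).ncard < ℓ := by
    intro v
    refine lt_of_le_of_lt ?_ (lt_of_le_of_lt (ncard_quadraticResidues_le hF)
      (by omega : Nat.card F / 2 < ℓ))
    refine Set.ncard_le_ncard_of_injOn (fun u => u.1 - v.1) (fun u hu => ?_) ?_ (Set.toFinite _)
    · rw [SimpleGraph.mem_neighborSet, SimpleGraph.addCayley_adj_iff_sub_mem hS0 hSneg] at hu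
      exact (mem_voltageSet.1 hu).1
    · intro u hu w hw huw
      rw [SimpleGraph.mem_neighborSet, SimpleGraph.addCayley_adj_iff_sub_mem hS0 hSneg] at hu hw
      obtain ⟨s, hs⟩ := hu
      obtain ⟨t, ht⟩ := hw
      have hst : s = t := by
        refine Subtype.ext ?_
        exact (Prod.ext_iff.1 hs).1.symm.trans (Eq.trans huw (Prod.ext_iff.1 ht).1)
      rw [hst, ← ht] at hs
      exact sub_left_injective hs
  have htrans : ∀ v w, ∃ σ : SimpleGraph.addCayley (voltageSet α) ≃g
      SimpleGraph.addCayley (voltageSet α), σ v = w := fun v w =>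
    ⟨SimpleGraph.addCayleyTranslation _ (w - v), sub_add_cancel w v⟩
  have hcardG : ¬ ℓ ^ 2 ∣ Nat.card (F × ZMod ℓ) := by
    rw [Nat.card_prod, Nat.card_zmod, sq, Nat.mul_dvd_mul_iff_right hℓ.pos, hcard]
    exact fun h => hℓp ((Nat.prime_dvd_prime_iff_eq hℓ hp).1 (hℓ.dvd_of_dvd_pow h))
  have hord : addOrderOf ((0 : F), (1 : ZMod ℓ)) = ℓ := by
    refine addOrderOf_eq_prime ?_ fun h => one_ne_zero (Prod.ext_iff.1 h).2
    ext <;> simp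
  obtain ⟨ψ, k, hψ⟩ := (SimpleGraph.addCayley_preconnected hclosure).exists_iso_map_eq_pow hℓ hdeg
    htrans hcardG φ
    ((SimpleGraph.orderOf_addCayleyTranslation (voltageSet α) ((0 : F), (1 : ZMod ℓ))).trans hord)
    ((SimpleGraph.orderOf_addCayleyTranslation T ((0 : F), (1 : ZMod ℓ))).trans hord)
  have hstep : ∀ v, ψ ((0, 1) + v) = (0, (k : ZMod ℓ)) + ψ v := by
    intro v
    have := hψ v
    rw [SimpleGraph.addCayleyTranslation_pow_apply] at this
    refine this.trans ?_
    congr 1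
    ext <;> simp
  have hfiber : ∀ x (z : ZMod ℓ), ψ (x, z) = ψ (x, 0) + ((0 : F), (k : ZMod ℓ) * z) := by
    intro x z
    have hnat : ∀ m : ℕ, ψ (x, (m : ZMod ℓ)) = ψ (x, 0) + ((0 : F), (k : ZMod ℓ) * m) := by
      intro m
      induction m with
      | zero => simp [Prod.mk_zero_zero]
      | succ m ih =>
        have := hstep (x, m)
        rw [ih] at this
        convert this using 1
        · simp [add_comm]
        · ext
          · simp
          · simp
            ring
    have := hnat z.val
    rwa [ZMod.natCast_zmod_val] at this
  refine exists_addEquiv_image_voltageSet_eq hF h2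
    (ψ.toEquiv.trans (Equiv.subRight (ψ 0))) (sub_self _) (fun u v => ?_) (c := k) fun x z => ?_
  · change ψ v - ψ 0 - (ψ u - ψ 0) ∈ T ↔ _
    rw [sub_sub_sub_cancel_right, ← SimpleGraph.addCayley_adj_iff_sub_mem hT0 hTneg,
      ← SimpleGraph.addCayley_adj_iff_sub_mem hS0 hSneg]
    exact ψ.map_adj_iff
  · change ψ (x, z) - ψ 0 = ψ (x, 0) - ψ 0 + _
    rw [hfiber]
    abel
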